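/- **Lemma (Main Edge-Weighted Lemma).** Fix $c := 2\sqrt{2}-2$. Let $G=(L,R,E)$ be a finite bipartite graph with $E \subseteq L\times R$ and non-negative edge weights $w=(w_e)_{e\in E}$, and let $\vec x=(x_e)_{e\in E}$ be a fractional matching of $G$; that is, $x_e\ge 0$ for all $e \in E$, and $x_v:=\sum_{e\in E:\, v\in e}x_e\le 1$ for every vertex $v\in L\cup R$. Let $(A_v)_{v\in R}$ be random variables on a common probability space with values in $\{0,1\}$ that are negatively associated: for all disjoint $S,T\subseteq R$ and all monotone increasing (Borel) functions $f:[0,1]^{S}\to\mathbb R$ and $g:[0,1]^{T}\to\mathbb R$, $$\mathbb E\big[f((A_v)_{v\in S})\,g((A_v)_{v\in T})\big]\le \mathbb E\big[f((A_v)_{v\in S})\big]\;\mathbb E\big[g((A_v)_{v\in T})\big].$$ Let $G_A$ denote the random subgraph of $G$ induced by $L\cup\{v\in R: A_v=1\}$, and let $\nu(G_A,w)$ denote the maximum total weight $\sum_{e\in M}w_e$ of a matching $M$ in $G_A$. If $$\Pr[A_v=1]\ \ge\ 1-c\,(1-x_v)\qquad\text{for all } v\in R,$$ then $$\mathbb E[\nu(G_A,w)]\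 \ge\ c\cdot\sum_{e\in E}w_e x_e .$$ -/

import Mathlib

open MeasureTheory

namespace BipartiteMatching

/-- Negative association of a family of `[0,1]`-valued random variables: for disjoint index sets
`S`, `T` and monotone increasing `f : [0,1]^S → ℝ`, `g : [0,1]^T → ℝ`,
`E[f(X_S) g(X_T)] ≤ E[f(X_S)] E[g(X_T)]`. The functions range over Borel functions, so that the
expectations exist (a monotone function on `[0,1]^S` is bounded). -/
def NegAssoc {Ω ι : Type*} [MeasurableSpace Ω] (μ : Measure Ω)
    (X : ι → Ω → unitInterval) : Prop :=
  ∀ S T : Finset ι, Disjoint S T →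
    ∀ (f : (S → unitInterval) → ℝ) (g : (T → unitInterval) → ℝ),
      Monotone f → Monotone g → Measurable f → Measurable g →
        ∫ ω, f (fun i => X i ω) * g (fun i => X i ω) ∂μ ≤
          (∫ ω, f (fun i => X i ω) ∂μ) * ∫ ω, g (fun i => X i ω) ∂μ

/- A bipartite graph `G = (L, R, E)` is given by its edge set `E ⊆ L × R`. -/
section Graph

variable {L R : Type*}

open Classical in
/-- The fractional degree `x_u` of a left vertex: the sum of `x_e` over the edges `e` at `u`. -/
noncomputable def leftDegree (E : Finset (L × R)) (x : L × R → ℝ) (u : L) : ℝ :=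
  ∑ e ∈ E with e.1 = u, x e

open Classical in
/-- The fractional degree `x_v` of a right vertex: the sum of `x_e` over the edges `e` at `v`. -/
noncomputable def rightDegree (E : Finset (L × R)) (x : L × R → ℝ) (v : R) : ℝ :=
  ∑ e ∈ E with e.2 = v, x e

/-- `x` (only its values on `E` matter) is a fractional matching of the graph with edge set `E`. -/
structure IsFractionalMatching (E : Finset (L × R)) (x : L × R → ℝ) : Prop where
  nonneg : ∀ e ∈ E, 0 ≤ x e
  left_le_one : ∀ u, leftDegree E x u ≤ 1
  right_le_one : ∀ v, rightDegree E x v ≤ 1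

/-- `M` is a matching of the graph with edge set `E`: a set of edges no two of which share
an endpoint. -/
def IsMatching (E M : Finset (L × R)) : Prop :=
  M ⊆ E ∧ ∀ e ∈ M, ∀ e' ∈ M, e ≠ e' → e.1 ≠ e'.1 ∧ e.2 ≠ e'.2

open Classical in
/-- The finite set of all matchings of the graph with edge set `E`. -/
noncomputable def matchings (E : Finset (L × R)) : Finset (Finset (L × R)) :=
  {M ∈ E.powerset | IsMatching E M}

theorem mem_matchings {E M : Finset (L × R)} : M ∈ matchings E ↔ IsMatching E M := by
  simp only [matchings, Finset.mem_filter, Finset.mem_powerset, and_iff_right_iff_imp]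
  exact fun h => h.1

theorem matchings_nonempty (E : Finset (L × R)) : (matchings E).Nonempty :=
  ⟨∅, mem_matchings.2 ⟨by simp, by simp⟩⟩

/-- `ν(G, w)`: the maximum of the total weight `∑ e ∈ M, w e` over all matchings `M` of `G`. -/
noncomputable def maxWeightMatching (E : Finset (L × R)) (w : L × R → ℝ) : ℝ :=
  (matchings E).sup' (matchings_nonempty E) (fun M => ∑ e ∈ M, w e)

open Classical in
/-- The edge set of the subgraph induced by all left vertices and the right vertices in `S`. -/
noncomputable def inducedEdges (E : Finset (L × R)) (S : Set R) : Finset (L × R) :=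
  {e ∈ E | e.2 ∈ S}

end Graph

end BipartiteMatching

/-!
Write `c = 2√2 - 2`, so that `1 - c² / 4 = c`. The proof first reduces edge weights to vertex
weights, and then rounds a fractional matching by serving the left vertices one at a time.

*Reduction.* Replace `x` by a fractional matching `z` of maximum weight with right degrees at most
those of `x`. By linear programming duality (`exists_cover_of_weight_le`, proved by separating a
point from an open convex set) and complementary slackness (`weight_eq_of_cover_le`) there are
vertex weights `α, β ≥ 0` with `w u v = α u + β v` on the support of `z`. For each outcome, duality
and the integrality of the matching polytope (`weight_le_maxWeightMatching`, from Birkhoff's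
theorem) express `ν(G_A, w)` as the value of a fractional vertex cover of `α u + β v`. Such a cover
splits into a cover of `α` and a cover of `β`, and a cover of `β` splits further into covers of the
layers of `β` (`exists_le_cover_of_right_weights`). By weak duality it is therefore enough to find,
for the support of `z` and for its restrictions to sets of right vertices, a random fractional
matching with right capacities `A` in which every left vertex has expected degree at least `c`
times its degree in `z`.

*Rounding* (`exists_isRandomMatching`). Moving along circulations, which changes no degree, makes
the support circulation-free; then some left vertex `u` has at most one neighbour `v₀` that is not
a leaf (`exists_circulation_or_exists_leaves`). Let `u` use up its leaves, and then the fraction `θ`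
of `v₀` on the part of `u` that the leaves left unserved, with `θ ≤ 1` as large as possible subject
to the expected use of `v₀` being at most `c x u v₀`. The capacity that remains at `v₀` is a
monotone function of disjoint variables, so negative association persists (`NegAssoc.residual`), and
its expectation is still large enough for the graph without `u`. If `θ = 1`, negative association
bounds the expected unserved part of `u` by `∏ c (1 - xᵥ)` over all neighbours; otherwise `v₀`
contributes exactly `c x u v₀`, and the same bound is applied to the leaves. Both cases are settled
by the inequality `∏ c (1 - xᵥ) ≤ 1 - c ∑ xᵥ` for `∑ xᵥ ≤ 1` (`prod_ratio_mul_one_sub_le`), which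
determines the constant.
-/

namespace BipartiteMatching

/-! ### The numerical inequality -/

/-- The constant `c = 2√2 - 2`. -/
noncomputable def ratio : ℝ := 2 * Real.sqrt 2 - 2

theorem ratio_sq : ratio ^ 2 = 4 - 4 * ratio := by
  have h : Real.sqrt 2 ^ 2 = 2 := Real.sq_sqrt (by norm_num)
  unfold ratio
  linear_combination 4 * h

theorem ratio_pos : 0 < ratio := by
  have : (1 : ℝ) < Real.sqrt 2 := by
    rw [Real.lt_sqrt] <;> norm_num
  unfold ratio
  linarith

theorem ratio_mem_Ioo : ratio ∈ Set.Ioo (0.828 : ℝ) 0.829 := by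
  have h := ratio_sq
  have h0 := ratio_pos
  constructor <;> nlinarith

/-- The list form of `prod_ratio_mul_one_sub_le`. Four or more numbers are reduced to fewer by
merging two of them with sum at most `1 / 2`, which increases the left-hand side. -/
theorem list_prod_ratio_mul_one_sub_le (l : List ℝ) (h0 : ∀ a ∈ l, 0 ≤ a) (h1 : l.sum ≤ 1) :
    (l.map fun a => ratio * (1 - a)).prod ≤ 1 - ratio * l.sum := by
  have hc := ratio_sq
  obtain ⟨hc1, hc2⟩ := ratio_mem_Ioo
  norm_num at hc1 hc2
  have hcp := ratio_pos
  -- replacing `a, b` by `a + b` increases the product when `a + b ≤ 1 / 2`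
  have merge : ∀ a b : ℝ, 0 ≤ a → 0 ≤ b → a + b ≤ 1 / 2 →
      (ratio * (1 - a)) * (ratio * (1 - b)) ≤ ratio * (1 - (a + b)) := by
    intro a b ha hb hab
    have h4 : a * b ≤ 1 / 16 := by nlinarith [sq_nonneg (a - b)]
    have : ratio * (1 - a) * (1 - b) ≤ 1 - (a + b) := by nlinarith
    nlinarith
  match l, h0, h1 with
  | [], _, _ => simp
  | [a], h0, h1 =>
    simp at h0 h1 ⊢
    nlinarith
  | [a, b], h0, h1 =>
    simp at h0 h1 ⊢
    obtain ⟨ha, hb⟩ := h0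
    set S := a + b with hS
    have h2 : (1 - a) * (1 - b) ≤ (1 - S / 2) ^ 2 := by rw [hS]; nlinarith [sq_nonneg (a - b)]
    have h3 : ratio ^ 2 * (1 - S / 2) ^ 2 ≤ 1 - ratio * S := by
      rw [hc]
      nlinarith [mul_nonneg (sub_nonneg.2 h1) (add_nonneg ha hb)]
    have h4 : ratio * (1 - a) * (ratio * (1 - b)) = ratio ^ 2 * ((1 - a) * (1 - b)) := by ring
    rw [h4]
    exact (mul_le_mul_of_nonneg_left h2 (by positivity)).trans h3
  | [a, b, d], h0, h1 =>
    simp at h0 h1 ⊢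
    obtain ⟨ha, hb, hd⟩ := h0
    have h2 : (1 - a) * ((1 - b) * (1 - d)) ≤ 1 - 19 / 27 * (a + (b + d)) := by
      -- the arithmetic-geometric mean inequality, then convexity of `(1 - S / 3) ^ 3` on `[0, 1]`
      have hS0 : 0 ≤ a + (b + d) := by positivity
      have hA : (1 - a) * ((1 - b) * (1 - d)) ≤ (1 - (a + (b + d)) / 3) ^ 3 := by
        have key : ∀ x y z : ℝ, 0 ≤ x → 0 ≤ y → 0 ≤ z →
            x * (y * z) ≤ ((x + y + z) / 3) ^ 3 := by
          intro x y z hx hy hz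
          nlinarith [mul_nonneg hx (sq_nonneg (y - z)), mul_nonneg hy (sq_nonneg (x - z)),
            mul_nonneg hz (sq_nonneg (x - y)), mul_nonneg hx (sq_nonneg (x - y)),
            mul_nonneg hx (sq_nonneg (x - z)), mul_nonneg hy (sq_nonneg (x - y)),
            mul_nonneg hy (sq_nonneg (y - z)), mul_nonneg hz (sq_nonneg (x - z)),
            mul_nonneg hz (sq_nonneg (y - z))]
        refine (key (1 - a) (1 - b) (1 - d) (by linarith) (by linarith) (by linarith)).trans_eq ?_
        ring
      generalize a + (b + d) = S at *
      nlinarith [mul_nonneg hS0 (sub_nonneg.2 h1), mul_nonneg (mul_nonneg hS0 hS0) (sub_nonneg.2 h1)]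
    have h3 : ratio ^ 3 = 20 * ratio - 16 := by
      linear_combination (ratio - 4) * hc
    have h4 : ratio * (1 - a) * (ratio * (1 - b) * (ratio * (1 - d))) =
      ratio ^ 3 * ((1 - a) * ((1 - b) * (1 - d))) := by ring
    rw [h4, h3]
    have h5 := mul_le_mul_of_nonneg_left h2 (show 0 ≤ 20 * ratio - 16 by linarith)
    nlinarith [add_nonneg ha (add_nonneg hb hd)]
  | a :: b :: d :: e :: r, h0, h1 =>
    have ih1 := list_prod_ratio_mul_one_sub_le ((a + b) :: d :: e :: r)
    have ih2 := list_prod_ratio_mul_one_sub_le (a :: b :: (d + e) :: r)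
    simp only [List.mem_cons, forall_eq_or_imp, List.sum_cons, List.map_cons,
      List.prod_cons] at h0 h1 ih1 ih2 ⊢
    obtain ⟨ha, hb, hd, he, hr⟩ := h0
    have hrs : 0 ≤ r.sum := List.sum_nonneg hr
    have hr1 : ∀ z ∈ r, z ≤ 1 := fun z hz => by
      have := List.single_le_sum hr z hz
      linarith
    have hrp : 0 ≤ (r.map fun a => ratio * (1 - a)).prod := by
      apply List.prod_nonneg
      intro z hz
      obtain ⟨y, hy, rfl⟩ := List.mem_map.1 hz
      exact mul_nonneg hcp.le (sub_nonneg.2 (hr1 y hy))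
    have hf : ∀ z, z ≤ 1 → 0 ≤ ratio * (1 - z) := fun z hz =>
      mul_nonneg hcp.le (sub_nonneg.2 hz)
    rcases le_total (a + b) (1 / 2) with hab | hab
    · have := ih1 ⟨by positivity, hd, he, hr⟩ (by linarith)
      have h2 := mul_le_mul_of_nonneg_right (merge a b ha hb hab)
        (mul_nonneg (hf d (by linarith)) (mul_nonneg (hf e (by linarith)) hrp))
      linarith
    · have := ih2 ⟨ha, hb, by positivity, hr⟩ (by linarith)
      have h2 := mul_le_mul_of_nonneg_left (merge d e hd he (by linarith))
        (mul_nonneg (hf a (by linarith)) (mul_nonneg (hf b (by linarith)) hrp))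
      linarith
  termination_by l.length

/-- The inequality behind the constant: `∏ c (1 - xᵢ) ≤ 1 - c ∑ xᵢ` whenever `∑ xᵢ ≤ 1`.
It is tight for two numbers equal to `1 / 2`. -/
theorem prod_ratio_mul_one_sub_le {ι : Type*} (s : Finset ι) (x : ι → ℝ)
    (h0 : ∀ i ∈ s, 0 ≤ x i) (h1 : ∑ i ∈ s, x i ≤ 1) :
    ∏ i ∈ s, ratio * (1 - x i) ≤ 1 - ratio * ∑ i ∈ s, x i := by
  have := list_prod_ratio_mul_one_sub_le (s.toList.map x) (by simpa using h0)
    (by rwa [Finset.sum_map_toList])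
  rwa [List.map_map, Finset.sum_map_toList, Function.comp_def, Finset.prod_map_toList] at this

/-! ### Negative association -/

section NegAssoc

variable {Ω ι : Type*} [MeasurableSpace Ω] {μ : Measure Ω}

/-- Negative association is inherited by monotone functions of pairwise disjoint blocks of the
variables. The block `D j` is encoded by letting `H j` depend only on the coordinates in `D j`. -/
theorem NegAssoc.comp_blocks {κ : Type*} {X : ι → Ω → unitInterval} (hX : NegAssoc μ X)
    (D : κ → Finset ι) (hD : Pairwise fun j k => Disjoint (D j) (D k))
    (H : κ → (ι → unitInterval) → unitInterval) (hmono : ∀ j, Monotone (H j))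
    (hmeas : ∀ j, Measurable (H j))
    (hdep : ∀ j a b, (∀ i ∈ D j, a i = b i) → H j a = H j b) :
    NegAssoc μ fun j ω => H j fun i => X i ω := by
  classical
  intro S T hST f g hf hg hfm hgm
  -- the extension by zero of a family on a set of indices
  let ext (S : Finset κ) (a : S.biUnion D → unitInterval) : ι → unitInterval :=
    fun i => if h : i ∈ S.biUnion D then a ⟨i, h⟩ else 0
  have hextmono : ∀ S, Monotone (ext S) := by
    intro S a b hab i
    by_cases h : i ∈ S.biUnion D
    · simpa only [ext, h, dite_true] using hab _
    · simp only [ext, h, dite_false, le_refl]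
  have hextmeas : ∀ S, Measurable (ext S) := by
    intro S
    refine measurable_pi_lambda _ fun i => ?_
    by_cases h : i ∈ S.biUnion D
    · simpa only [ext, h, dite_true] using measurable_pi_apply _
    · simp only [ext, h, dite_false, measurable_const]
  have hext : ∀ (S : Finset κ) (ω : Ω) (j : S),
      H j (ext S fun i => X i ω) = H j fun i => X i ω := by
    intro S ω j
    refine hdep _ _ _ fun i hi => ?_
    have h : i ∈ S.biUnion D := Finset.mem_biUnion.2 ⟨j, j.2, hi⟩
    simp only [ext, h, dite_true]
  have hdisj : Disjoint (S.biUnion D) (T.biUnion D) := by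
    rw [Finset.disjoint_biUnion_left]
    intro j hj
    rw [Finset.disjoint_biUnion_right]
    intro k hk
    exact hD fun h => Finset.disjoint_left.1 hST hj (h ▸ hk)
  have := hX _ _ hdisj (fun a => f fun j => H j (ext S a)) (fun a => g fun j => H j (ext T a))
    (fun a b hab => hf fun j => hmono _ (hextmono S hab))
    (fun a b hab => hg fun j => hmono _ (hextmono T hab))
    (hfm.comp (measurable_pi_lambda _ fun j => (hmeas j).comp (hextmeas S)))
    (hgm.comp (measurable_pi_lambda _ fun j => (hmeas j).comp (hextmeas T)))
  simpa only [hext] using this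

theorem integrable_of_mem_Icc [IsFiniteMeasure μ] {f : Ω → ℝ} (hf : Measurable f)
    (h : ∀ ω, f ω ∈ Set.Icc (0 : ℝ) 1) : Integrable f μ :=
  Integrable.of_bound hf.aestronglyMeasurable 1 <| Filter.Eventually.of_forall fun ω => by
    rw [Real.norm_eq_abs, abs_of_nonneg (h ω).1]
    exact (h ω).2

theorem prod_one_sub_mem_Icc (s : Finset ι) (a : ι → unitInterval) :
    ∏ i ∈ s, (1 - (a i : ℝ)) ∈ Set.Icc (0 : ℝ) 1 :=
  ⟨Finset.prod_nonneg fun i _ => sub_nonneg.2 (a i).2.2,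
    Finset.prod_le_one (fun i _ => sub_nonneg.2 (a i).2.2) fun i _ => by
      linarith [(a i).2.1]⟩

theorem measurable_prod_one_sub {X : ι → Ω → unitInterval} (hm : ∀ i, Measurable (X i))
    (s : Finset ι) : Measurable fun ω => ∏ i ∈ s, (1 - (X i ω : ℝ)) :=
  Finset.measurable_prod _ fun i _ => (measurable_subtype_coe.comp (hm i)).const_sub 1

theorem NegAssoc.integral_prod_one_sub_le [IsProbabilityMeasure μ] {X : ι → Ω → unitInterval}
    (hX : NegAssoc μ X) (hm : ∀ i, Measurable (X i)) (s : Finset ι) :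
    ∫ ω, ∏ i ∈ s, (1 - (X i ω : ℝ)) ∂μ ≤ ∏ i ∈ s, (1 - ∫ ω, (X i ω : ℝ) ∂μ) := by
  classical
  have hint : ∀ i, Integrable (fun ω => (X i ω : ℝ)) μ := fun i =>
    integrable_of_mem_Icc (measurable_subtype_coe.comp (hm i)) fun ω => (X i ω).2
  induction s using Finset.induction_on with
  | empty => simp
  | insert i s hi ih =>
    have h := hX {i} s (by simpa using hi) (fun a => -(1 - (a ⟨i, by simp⟩ : ℝ)))
      (fun a => -∏ j : s, (1 - (a j : ℝ)))
      (fun a b hab => by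
        have : (a ⟨i, by simp⟩ : ℝ) ≤ b ⟨i, by simp⟩ := hab _
        simpa using this)
      (fun a b hab => neg_le_neg <| Finset.prod_le_prod (fun j _ => sub_nonneg.2 (b j).2.2)
        fun j _ => sub_le_sub_left (show (a j : ℝ) ≤ b j from hab j) 1)
      (by fun_prop) (by fun_prop)
    simp only [neg_mul_neg, integral_neg] at h
    have hcoe : ∀ ω, ∏ j : s, (1 - (X j ω : ℝ)) = ∏ j ∈ s, (1 - (X j ω : ℝ)) := fun ω =>
      Finset.prod_coe_sort s fun j => 1 - (X j ω : ℝ)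
    simp only [hcoe] at h
    simp only [Finset.prod_insert hi]
    rw [integral_sub (integrable_const _) (hint i)] at h
    simp only [integral_const, probReal_univ, one_smul] at h
    refine h.trans (mul_le_mul_of_nonneg_left ih ?_)
    rw [sub_nonneg]
    calc ∫ ω, (X i ω : ℝ) ∂μ ≤ ∫ _, (1 : ℝ) ∂μ :=
          integral_mono (hint i) (integrable_const _) fun ω => (X i ω).2.2
      _ = 1 := by simp

end NegAssoc

/-! ### Bipartite graphs without circulations -/

section Circulation

variable {L R : Type*} [Fintype L] [Fintype R]

/-- A nonempty bipartite graph, given by its adjacency relation `r`, either carries a nonzero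
circulation (signed edge weights with all degrees zero), or has a left vertex with at most one
neighbour that is not a leaf. Otherwise the edges whose right endpoint is not a leaf form a graph
of minimum degree at least two, which has too many edges for its incidence map to be injective. -/
theorem exists_circulation_or_exists_leaves (r : L → R → Prop) (hr : ∃ u v, r u v) :
    (∃ z : L → R → ℝ, (∃ u v, z u v ≠ 0) ∧ (∀ u v, z u v ≠ 0 → r u v) ∧
      (∀ u, ∑ v, z u v = 0) ∧ ∀ v, ∑ u, z u v = 0) ∨
    ∃ u v₀, r u v₀ ∧ ∀ v, v ≠ v₀ → r u v → ∀ u', r u' v → u' = u := by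
  classical
  refine or_iff_not_imp_right.2 fun hno => ?_
  push Not at hno
  obtain ⟨u₁, v₁, hr₁⟩ := hr
  -- the edges whose right endpoint is not a leaf
  let F : Finset (L × R) := {e | r e.1 e.2 ∧ ∃ u', r u' e.2 ∧ u' ≠ e.1}
  have hF : ∀ u v, (u, v) ∈ F ↔ r u v ∧ ∃ u', r u' v ∧ u' ≠ u := fun u v => by simp [F]
  let LF := F.image Prod.fst
  let RF := F.image Prod.snd
  have hL : 2 * LF.card ≤ F.card := by
    rw [Finset.card_eq_sum_card_image Prod.fst F, mul_comm, ← smul_eq_mul]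
    refine Finset.card_nsmul_le_sum _ _ _ fun u hu => ?_
    obtain ⟨⟨u', v⟩, he, rfl⟩ := Finset.mem_image.1 hu
    obtain ⟨v', hv', h1, h2⟩ := hno u' v ((hF _ _).1 he).1
    exact Finset.one_lt_card.2 ⟨(u', v), by simpa using he, (u', v'),
      by simpa using (hF _ _).2 ⟨h1, h2⟩, by simp [hv'.symm]⟩
  have hR : 2 * RF.card ≤ F.card := by
    rw [Finset.card_eq_sum_card_image Prod.snd F, mul_comm, ← smul_eq_mul]
    refine Finset.card_nsmul_le_sum _ _ _ fun v hv => ?_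
    obtain ⟨⟨u, v'⟩, he, rfl⟩ := Finset.mem_image.1 hv
    obtain ⟨h1, u', h2, h3⟩ := (hF _ _).1 he
    exact Finset.one_lt_card.2 ⟨(u, v'), by simpa using he, (u', v'),
      by simpa using (hF _ _).2 ⟨h2, u, h1, h3.symm⟩, by simp [h3.symm]⟩
  obtain ⟨v₂, -, h1, h2⟩ := hno u₁ v₁ hr₁
  have hv₂ : v₂ ∈ RF := Finset.mem_image.2 ⟨(u₁, v₂), (hF _ _).2 ⟨h1, h2⟩, rfl⟩
  -- the degree constraint at `v₂` follows from the others and is left out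
  let φ : (L × R → ℝ) →ₗ[ℝ] (LF → ℝ) × (RF.erase v₂ → ℝ) × ((Fᶜ : Finset (L × R)) → ℝ) :=
    { toFun := fun z => (fun u => ∑ v, z (u, v), fun v => ∑ u, z (u, v), fun e => z e)
      map_add' := fun z z' => by
        ext <;> simp [Finset.sum_add_distrib]
      map_smul' := fun t z => by
        ext <;> simp [Finset.mul_sum] }
  have hφ : φ.ker ≠ ⊥ := by
    refine LinearMap.ker_ne_bot_of_finrank_lt ?_
    rw [Module.finrank_prod, Module.finrank_prod, Module.finrank_fintype_fun_eq_card,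
      Module.finrank_fintype_fun_eq_card, Module.finrank_fintype_fun_eq_card,
      Module.finrank_fintype_fun_eq_card, Fintype.card_coe, Fintype.card_coe, Fintype.card_coe,
      Finset.card_erase_of_mem hv₂]
    have := Finset.card_add_card_compl F
    have := Finset.card_pos.2 ⟨v₂, hv₂⟩
    omega
  obtain ⟨z, hz, hz0⟩ := (Submodule.ne_bot_iff _).1 hφ
  have hz' := LinearMap.mem_ker.1 hz
  simp only [φ, LinearMap.coe_mk, AddHom.coe_mk, Prod.mk_eq_zero] at hz'
  obtain ⟨hzL, hzR, hzF⟩ := hz'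
  have hsupp : ∀ e, e ∉ F → z e = 0 := fun e he =>
    congrFun hzF ⟨e, Finset.mem_compl.2 he⟩
  have hdL : ∀ u, ∑ v, z (u, v) = 0 := by
    intro u
    by_cases hu : u ∈ LF
    · exact congrFun hzL ⟨u, hu⟩
    · exact Finset.sum_eq_zero fun v _ => hsupp _ fun h => hu (Finset.mem_image_of_mem _ h)
  have hdR' : ∀ v, v ≠ v₂ → ∑ u, z (u, v) = 0 := by
    intro v hv
    by_cases hu : v ∈ RF
    · exact congrFun hzR ⟨v, Finset.mem_erase.2 ⟨hv, hu⟩⟩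
    · exact Finset.sum_eq_zero fun u _ => hsupp _ fun h => hu (Finset.mem_image_of_mem _ h)
  refine ⟨fun u v => z (u, v), ?_, fun u v h => ?_, hdL, fun v => ?_⟩
  · obtain ⟨⟨u, v⟩, h⟩ := Function.ne_iff.1 hz0
    exact ⟨u, v, h⟩
  · exact ((hF u v).1 (not_imp_comm.1 (hsupp (u, v)) h)).1
  · by_cases hv : v = v₂
    · subst hv
      have h : ∑ v', ∑ u, z (u, v') = ∑ u, z (u, v) :=
        Finset.sum_eq_single v (fun v' _ h => hdR' v' h) fun h => absurd (Finset.mem_univ v) h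
      rw [← h, Finset.sum_comm]
      exact Finset.sum_eq_zero fun u _ => hdL u
    · exact hdR' v hv

/-- A nonnegative matrix whose support carries a circulation can be moved along it until an entry
vanishes; row and column sums do not change. -/
theorem exists_support_ssubset_of_circulation (x z : L → R → ℝ) (hx : ∀ u v, 0 ≤ x u v)
    (hz : ∃ u v, z u v ≠ 0) (hzx : ∀ u v, z u v ≠ 0 → x u v ≠ 0)
    (hzL : ∀ u, ∑ v, z u v = 0) (hzR : ∀ v, ∑ u, z u v = 0) :
    ∃ x' : L → R → ℝ, (∀ u v, 0 ≤ x' u v) ∧ (∀ u v, x' u v ≠ 0 → x u v ≠ 0) ∧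
      (∃ u v, x' u v = 0 ∧ x u v ≠ 0) ∧ (∀ u, ∑ v, x' u v = ∑ v, x u v) ∧
      ∀ v, ∑ u, x' u v = ∑ u, x u v := by
  classical
  obtain ⟨u, v, huv⟩ := hz
  obtain ⟨v', -, hv'⟩ := Finset.exists_pos_of_sum_zero_of_exists_nonzero (s := Finset.univ)
    (fun v => -z u v) (by simp [hzL]) ⟨v, Finset.mem_univ _, neg_ne_zero.2 huv⟩
  let N : Finset (L × R) := {e | z e.1 e.2 < 0}
  have hN : N.Nonempty := ⟨(u, v'), by simpa [N] using hv'⟩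
  obtain ⟨⟨a, b⟩, hab, hmin⟩ := N.exists_min_image (fun e => x e.1 e.2 / -z e.1 e.2) hN
  have hab' : z a b < 0 := by simpa [N] using hab
  set t := x a b / -z a b with ht
  have ht0 : 0 ≤ t := div_nonneg (hx _ _) (by linarith)
  refine ⟨fun u v => x u v + t * z u v, fun u v => ?_, fun u v h => ?_, ⟨a, b, ?_, ?_⟩,
    fun u => ?_, fun v => ?_⟩
  · rcases lt_or_ge (z u v) 0 with h | h
    · have := hmin (u, v) (by simpa [N] using h)
      rw [le_div_iff₀ (by linarith)] at this
      linarith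
    · have := hx u v
      positivity
  · contrapose! h
    have : z u v = 0 := not_imp_comm.1 (hzx u v) (not_not.2 h)
    simp [h, this]
  · have : z a b ≠ 0 := hab'.ne
    rw [ht]
    field_simp
    ring
  · exact hzx a b hab'.ne
  · rw [Finset.sum_add_distrib, ← Finset.mul_sum, hzL, mul_zero, add_zero]
  · rw [Finset.sum_add_distrib, ← Finset.mul_sum, hzR, mul_zero, add_zero]

end Circulation

/-! ### Rounding a fractional matching -/

section Rounding

theorem one_sub_prod_one_sub_le_sum {ι : Type*} (s : Finset ι) (a : ι → unitInterval) :
    1 - ∏ i ∈ s, (1 - (a i : ℝ)) ≤ ∑ i ∈ s, (a i : ℝ) := by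
  classical
  induction s using Finset.induction_on with
  | empty => simp
  | insert i s hi ih =>
    rw [Finset.prod_insert hi, Finset.sum_insert hi]
    have := mul_le_mul_of_nonneg_left (prod_one_sub_mem_Icc s a).2 (a i).2.1
    linarith

variable {R Ω : Type*} [MeasurableSpace Ω]

open Classical in
/-- The capacities left over by a left vertex whose neighbours are `v₀` and the leaves in `K`.
It claims the leaves, and takes the fraction `θ` of `v₀` as far as it is not saturated by them.
The capacities of the leaves become irrelevant and are set to `1`. -/
noncomputable def residual (v₀ : R) (K : Finset R) (θ : unitInterval) (j : R)
    (a : R → unitInterval) : unitInterval :=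
  if j = v₀ then
    ⟨a v₀ * (1 - θ * ∏ i ∈ K, (1 - (a i : ℝ))), unitInterval.mul_mem (a v₀).2 <|
      Set.Icc.mem_iff_one_sub_mem.1 <| unitInterval.mul_mem θ.2 (prod_one_sub_mem_Icc K a)⟩
  else if j ∈ K then 1 else a j

theorem residual_self (v₀ : R) (K : Finset R) (θ : unitInterval) (a : R → unitInterval) :
    (residual v₀ K θ v₀ a : ℝ) = a v₀ * (1 - θ * ∏ i ∈ K, (1 - (a i : ℝ))) := by
  simp [residual]

theorem residual_of_mem {v₀ : R} {K : Finset R} {j : R} (hv₀ : j ≠ v₀) (hj : j ∈ K)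
    (θ : unitInterval) (a : R → unitInterval) : residual v₀ K θ j a = 1 := by
  simp [residual, hv₀, hj]

theorem residual_of_notMem {v₀ : R} {K : Finset R} {j : R} (hv₀ : j ≠ v₀) (hj : j ∉ K)
    (θ : unitInterval) (a : R → unitInterval) : residual v₀ K θ j a = a j := by
  simp [residual, hv₀, hj]

theorem monotone_residual (v₀ : R) (K : Finset R) (θ : unitInterval) (j : R) :
    Monotone (residual v₀ K θ j) := by
  intro a b hab
  have hab' : ∀ i, (a i : ℝ) ≤ b i := fun i => hab i
  by_cases hj : j = v₀
  · subst hj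
    rw [← Subtype.coe_le_coe, residual_self, residual_self]
    have hP : ∏ i ∈ K, (1 - (b i : ℝ)) ≤ ∏ i ∈ K, (1 - (a i : ℝ)) :=
      Finset.prod_le_prod (fun i _ => sub_nonneg.2 (b i).2.2) fun i _ =>
        sub_le_sub_left (hab' i) 1
    have h1 : (θ : ℝ) * ∏ i ∈ K, (1 - (a i : ℝ)) ≤ 1 :=
      mul_le_one₀ θ.2.2 (prod_one_sub_mem_Icc K a).1 (prod_one_sub_mem_Icc K a).2
    exact mul_le_mul (hab' j) (sub_le_sub_left (mul_le_mul_of_nonneg_left hP θ.2.1) 1)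
      (sub_nonneg.2 h1) (b j).2.1
  · by_cases hK : j ∈ K
    · rw [residual_of_mem hj hK, residual_of_mem hj hK]
    · rw [residual_of_notMem hj hK, residual_of_notMem hj hK]
      exact hab j

theorem measurable_residual (v₀ : R) (K : Finset R) (θ : unitInterval) (j : R) :
    Measurable (residual v₀ K θ j) := by
  by_cases hj : j = v₀
  · subst hj
    have : Measurable fun a : R → unitInterval => (residual j K θ j a : ℝ) := by
      simp only [residual_self]
      fun_prop
    exact this.subtype_mk (h := fun a => (residual j K θ j a).2)
  · by_cases hK : j ∈ K
    · simp only [funext (residual_of_mem hj hK θ), measurable_const]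
    · rw [funext (residual_of_notMem hj hK θ)]
      exact measurable_pi_apply j

theorem NegAssoc.residual {μ : Measure Ω} {A : R → Ω → unitInterval} (hA : NegAssoc μ A)
    (v₀ : R) (K : Finset R) (θ : unitInterval) :
    NegAssoc μ fun j ω => residual v₀ K θ j fun i => A i ω := by
  classical
  refine hA.comp_blocks
    (fun j => if j = v₀ then insert v₀ K else if j ∈ K then ∅ else {j}) ?_ _
    (monotone_residual v₀ K θ) (measurable_residual v₀ K θ) ?_
  · intro j k hjk
    split_ifs with h1 h2 h3 h4 h5 <;> simp_all
  · intro j a b hab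
    by_cases hj : j = v₀
    · subst hj
      simp only [if_true] at hab
      apply Subtype.ext
      rw [residual_self, residual_self, hab j (Finset.mem_insert_self _ _),
        Finset.prod_congr rfl fun i hi => by rw [hab i (Finset.mem_insert_of_mem hi)]]
    · by_cases hK : j ∈ K
      · rw [residual_of_mem hj hK, residual_of_mem hj hK]
      · rw [residual_of_notMem hj hK, residual_of_notMem hj hK]
        exact hab j (by simp [hj, hK])

variable {L : Type*} [Fintype L] [Fintype R]

/-- `y` is a random fractional matching with (random) right capacities `A`, supported on the
support of `x`. -/
structure IsRandomMatching (x : L → R → ℝ) (A : R → Ω → unitInterval)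
    (y : L → R → Ω → ℝ) : Prop where
  measurable : ∀ u v, Measurable (y u v)
  nonneg : ∀ u v ω, 0 ≤ y u v ω
  support : ∀ u v ω, x u v = 0 → y u v ω = 0
  left_le_one : ∀ u ω, ∑ v, y u v ω ≤ 1
  right_le : ∀ v ω, ∑ u, y u v ω ≤ A v ω

theorem IsRandomMatching.mono {x x' : L → R → ℝ} {A : R → Ω → unitInterval}
    {y : L → R → Ω → ℝ} (h : IsRandomMatching x' A y) (hx : ∀ u v, x' u v ≠ 0 → x u v ≠ 0) :
    IsRandomMatching x A y :=
  ⟨h.measurable, h.nonneg, fun u v ω h0 => h.support u v ω (not_imp_not.1 (hx u v) h0),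
    h.left_le_one, h.right_le⟩

theorem IsRandomMatching.integrable {μ : Measure Ω} [IsFiniteMeasure μ] {x : L → R → ℝ}
    {A : R → Ω → unitInterval} {y : L → R → Ω → ℝ} (h : IsRandomMatching x A y) (u : L) (v : R) :
    Integrable (y u v) μ :=
  integrable_of_mem_Icc (h.measurable u v) fun ω => ⟨h.nonneg u v ω,
    (Finset.single_le_sum (f := fun v => y u v ω) (fun v _ => h.nonneg u v ω)
      (Finset.mem_univ v)).trans (h.left_le_one u ω)⟩

/-- One step of the rounding, with `K` the set of neighbours of `u₀` other than `v₀`. The vertex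
`u₀` can be served with expected value at least `c` times its fractional degree, such that the
residual capacity of `v₀` satisfies the hypothesis on the marginals for the graph without `u₀`. -/
theorem exists_serve_left_vertex {μ : Measure Ω} [IsProbabilityMeasure μ]
    (x : L → R → ℝ) (hx0 : ∀ u v, 0 ≤ x u v) (hx1 : ∀ u, ∑ v, x u v ≤ 1)
    (A : R → Ω → unitInterval) (hm : ∀ v, Measurable (A v)) (hA : NegAssoc μ A)
    (hp : ∀ v, 1 - ratio * (1 - ∑ u, x u v) ≤ ∫ ω, (A v ω : ℝ) ∂μ)
    (u₀ : L) (v₀ : R) (K : Finset R) (hK : ∀ v, v ∈ K ↔ v ≠ v₀ ∧ x u₀ v ≠ 0) :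
    ∃ (θ : unitInterval) (g : R → Ω → ℝ), (∀ v, Measurable (g v)) ∧ (∀ v ω, 0 ≤ g v ω) ∧
      (∀ v ω, v ≠ v₀ → v ∉ K → g v ω = 0) ∧ (∀ ω, ∑ v, g v ω ≤ 1) ∧
      (∀ ω, g v₀ ω + residual v₀ K θ v₀ (fun i => A i ω) = A v₀ ω) ∧
      (∀ v ∈ K, ∀ ω, g v ω ≤ A v ω) ∧
      ratio * ∑ v, x u₀ v ≤ ∫ ω, ∑ v, g v ω ∂μ ∧
      1 - ratio * (1 - (∑ u, x u v₀ - x u₀ v₀)) ≤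
        ∫ ω, (residual v₀ K θ v₀ fun i => A i ω : ℝ) ∂μ := by
  classical
  have hc0 := ratio_pos
  have hv₀K : v₀ ∉ K := fun h => ((hK v₀).1 h).1 rfl
  have hxle : ∀ u v, x u v ≤ ∑ u, x u v := fun u v =>
    Finset.single_le_sum (f := fun u => x u v) (fun u _ => hx0 u v) (Finset.mem_univ u)
  have hAint : ∀ v, Integrable (fun ω => (A v ω : ℝ)) μ := fun v =>
    integrable_of_mem_Icc (measurable_subtype_coe.comp (hm v)) fun ω => (A v ω).2
  have hAle : ∀ v, ∫ ω, (A v ω : ℝ) ∂μ ≤ 1 := fun v =>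
    (integral_mono (hAint v) (integrable_const _) fun ω => (A v ω).2.2).trans_eq (by simp)
  -- the amount by which the leaves fail to saturate `u₀`
  set P : Ω → ℝ := fun ω => ∏ i ∈ K, (1 - (A i ω : ℝ)) with hPdef
  have hPm : Measurable P := measurable_prod_one_sub hm K
  have hP : ∀ ω, P ω ∈ Set.Icc (0 : ℝ) 1 := fun ω => prod_one_sub_mem_Icc K fun i => A i ω
  have hPint : Integrable P μ := integrable_of_mem_Icc hPm hP
  have hAPm : Measurable fun ω => (A v₀ ω : ℝ) * P ω :=
    (measurable_subtype_coe.comp (hm v₀)).mul hPm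
  have hAPint : Integrable (fun ω => (A v₀ ω : ℝ) * P ω) μ :=
    integrable_of_mem_Icc hAPm fun ω => unitInterval.mul_mem (A v₀ ω).2 (hP ω)
  -- the miss probabilities are at most `c (1 - xᵥ)`
  have hmiss : ∀ s : Finset R, ∏ v ∈ s, (1 - ∫ ω, (A v ω : ℝ) ∂μ) ≤
      ∏ v ∈ s, ratio * (1 - x u₀ v) := fun s => by
    refine Finset.prod_le_prod (fun v _ => sub_nonneg.2 (hAle v)) fun v _ => ?_
    have h1 := hp v
    have h2 := mul_le_mul_of_nonneg_left (hxle u₀ v) hc0.le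
    linarith
  have hsumle : ∀ s : Finset R, ∑ v ∈ s, x u₀ v ≤ 1 := fun s =>
    (Finset.sum_le_univ_sum_of_nonneg fun v => hx0 u₀ v).trans (hx1 u₀)
  have hmain : ∀ s : Finset R, ∫ ω, ∏ v ∈ s, (1 - (A v ω : ℝ)) ∂μ ≤
      1 - ratio * ∑ v ∈ s, x u₀ v := fun s =>
    ((hA.integral_prod_one_sub_le hm s).trans (hmiss s)).trans
      (prod_ratio_mul_one_sub_le s _ (fun v _ => hx0 u₀ v) (hsumle s))
  have hxsum : ∑ v, x u₀ v = x u₀ v₀ + ∑ v ∈ K, x u₀ v := by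
    rw [← Finset.sum_insert hv₀K]
    refine (Finset.sum_subset (Finset.subset_univ _) fun v _ hv => ?_).symm
    rw [Finset.mem_insert, hK] at hv
    push Not at hv
    exact hv.2 hv.1
  set q := ∫ ω, (A v₀ ω : ℝ) * P ω ∂μ with hq
  have hq0 : 0 ≤ q := integral_nonneg fun ω => mul_nonneg (A v₀ ω).2.1 (hP ω).1
  -- either all of `v₀` is on offer, or `u₀` uses exactly the fraction `c x` of it
  obtain ⟨θ, hθ1, hθ2⟩ : ∃ θ : unitInterval, (θ : ℝ) * q ≤ ratio * x u₀ v₀ ∧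
      ((θ : ℝ) = 1 ∨ (θ : ℝ) * q = ratio * x u₀ v₀) := by
    have h0 := mul_nonneg hc0.le (hx0 u₀ v₀)
    rcases le_total q (ratio * x u₀ v₀) with h | h
    · exact ⟨1, by simpa using h, Or.inl rfl⟩
    · rcases hq0.eq_or_lt with h' | h'
      · exact ⟨1, by simpa [← h'] using h0, Or.inl rfl⟩
      · have : ratio * x u₀ v₀ / q * q = ratio * x u₀ v₀ := div_mul_cancel₀ _ h'.ne'
        exact ⟨⟨ratio * x u₀ v₀ / q, div_nonneg h0 h'.le, (div_le_one h').2 h⟩, this.le,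
          Or.inr this⟩
  let S : Ω → ℝ := fun ω => ∑ i ∈ K, (A i ω : ℝ)
  have hSm : Measurable S :=
    Finset.measurable_sum _ fun i _ => measurable_subtype_coe.comp (hm i)
  have hS : ∀ ω, 1 - P ω ≤ S ω := fun ω => one_sub_prod_one_sub_le_sum K fun i => A i ω
  have hS0 : ∀ ω, 0 ≤ S ω := fun ω => Finset.sum_nonneg fun i _ => (A i ω).2.1
  let g : R → Ω → ℝ := fun v ω =>
    if v = v₀ then θ * (A v₀ ω * P ω) else if v ∈ K then (1 - P ω) * (A v ω / S ω) else 0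
  have hg0 : ∀ ω, g v₀ ω = θ * (A v₀ ω * P ω) := fun ω => by simp [g]
  have hgK : ∀ v ∈ K, ∀ ω, g v ω = (1 - P ω) * (A v ω / S ω) := fun v hv ω => by
    simp [g, hv, ((hK v).1 hv).1]
  have hgsum : ∀ ω, ∑ v, g v ω = θ * (A v₀ ω * P ω) + (1 - P ω) := by
    intro ω
    have h1 : ∑ v, g v ω = ∑ v ∈ insert v₀ K, g v ω := by
      refine (Finset.sum_subset (Finset.subset_univ _) fun v _ hv => ?_).symm
      rw [Finset.mem_insert, not_or] at hv
      simp [g, hv.1, hv.2]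
    rw [h1, Finset.sum_insert hv₀K, hg0, Finset.sum_congr rfl fun v hv => hgK v hv ω,
      ← Finset.mul_sum, ← Finset.sum_div]
    congr 1
    -- if the leaves have no capacity at all then `P ω = 1`
    rcases (hS0 ω).eq_or_lt with h | h
    · have h2 := hS ω
      have h3 := (hP ω).2
      have : P ω = 1 := by linarith
      simp [this]
    · change (1 - P ω) * (S ω / S ω) = _
      rw [div_self h.ne', mul_one]
  have hres : ∀ ω, (residual v₀ K θ v₀ (fun i => A i ω) : ℝ) =
      A v₀ ω - θ * (A v₀ ω * P ω) := fun ω => by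
    rw [residual_self]
    ring
  refine ⟨θ, g, fun v => ?_, fun v ω => ?_, fun v ω h1 h2 => by simp [g, h1, h2], fun ω => ?_,
    fun ω => by rw [hg0, hres]; ring, fun v hv ω => ?_, ?_, ?_⟩
  · by_cases h : v = v₀
    · simpa only [g, h, if_true] using hAPm.const_mul _
    · by_cases h' : v ∈ K
      · simp only [g, h, h', if_true, if_false]
        exact (hPm.const_sub 1).mul ((measurable_subtype_coe.comp (hm v)).div hSm)
      · simp only [g, h, h', if_false, measurable_const]
  · have h1 := (hP ω).1
    have h2 := sub_nonneg.2 (hP ω).2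
    have h3 := (A v₀ ω).2.1
    have h4 := (A v ω).2.1
    have h5 := hS0 ω
    have h6 := θ.2.1
    simp only [g]
    split_ifs <;> positivity
  · rw [hgsum]
    have h1 : (θ : ℝ) * (A v₀ ω * P ω) ≤ P ω := by
      rw [← mul_assoc]
      exact mul_le_of_le_one_left (hP ω).1 (mul_le_one₀ θ.2.2 (A v₀ ω).2.1 (A v₀ ω).2.2)
    linarith
  · rw [hgK v hv, ← mul_div_assoc]
    refine div_le_of_le_mul₀ (hS0 ω) (A v ω).2.1 ?_
    rw [mul_comm]
    exact mul_le_mul_of_nonneg_left (hS ω) (A v ω).2.1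
  · simp only [hgsum]
    have hPint' : Integrable (fun ω => 1 - P ω) μ := (integrable_const _).sub hPint
    rw [integral_add (hAPint.const_mul _) hPint', integral_const_mul,
      integral_sub (integrable_const _) hPint, ← hq]
    simp only [integral_const, probReal_univ, one_smul]
    rcases hθ2 with h | h
    · have h1 := hmain (insert v₀ K)
      simp only [Finset.prod_insert hv₀K, Finset.sum_insert hv₀K, ← hxsum, sub_mul, one_mul] at h1
      rw [integral_sub hPint hAPint, ← hq] at h1
      rw [h]
      linarith
    · have h1 := hmain K
      rw [h, hxsum]
      linarith
  · simp only [hres]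
    rw [integral_sub (hAint v₀) (hAPint.const_mul _), integral_const_mul, ← hq]
    have := hp v₀
    linarith

/-- Rounding with respect to left degrees: every left vertex keeps a `c` fraction of its fractional
degree in expectation. The support of `x` is made free of circulations first, which does not
change any degree, and then left vertices all of whose neighbours but one are leaves are served
one by one. -/
theorem exists_isRandomMatching {μ : Measure Ω} [IsProbabilityMeasure μ]
    (x : L → R → ℝ) (hx0 : ∀ u v, 0 ≤ x u v) (hx1 : ∀ u, ∑ v, x u v ≤ 1)
    (A : R → Ω → unitInterval) (hm : ∀ v, Measurable (A v)) (hA : NegAssoc μ A)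
    (hp : ∀ v, 1 - ratio * (1 - ∑ u, x u v) ≤ ∫ ω, (A v ω : ℝ) ∂μ) :
    ∃ y, IsRandomMatching x A y ∧ ∀ u, ratio * ∑ v, x u v ≤ ∫ ω, ∑ v, y u v ω ∂μ := by
  classical
  induction hn : (Finset.univ.filter fun e : L × R => x e.1 e.2 ≠ 0).card using
    Nat.strong_induction_on generalizing x A with
  | _ n ih =>
  subst hn
  have hcard : ∀ x' : L → R → ℝ, (∀ u v, x' u v ≠ 0 → x u v ≠ 0) →
      (∃ u v, x' u v = 0 ∧ x u v ≠ 0) →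
      (Finset.univ.filter fun e : L × R => x' e.1 e.2 ≠ 0).card <
        (Finset.univ.filter fun e : L × R => x e.1 e.2 ≠ 0).card := by
    rintro x' h1 ⟨u, v, h2, h3⟩
    refine Finset.card_lt_card ((Finset.ssubset_iff_of_subset fun e he => ?_).2
      ⟨(u, v), by simpa using h3, by simpa using h2⟩)
    simpa using h1 _ _ (by simpa using he)
  by_cases hne : ∃ u v, x u v ≠ 0
  swap
  · push Not at hne
    refine ⟨fun _ _ _ => 0, ⟨fun _ _ => measurable_const, by simp, by simp, by simp, ?_⟩, ?_⟩
    · intro v ω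
      simpa using (A v ω).2.1
    · simp [hne]
  rcases exists_circulation_or_exists_leaves (fun u v => x u v ≠ 0) hne with
    ⟨z, hz, hzx, hzL, hzR⟩ | ⟨u₀, v₀, h₀, hleaf⟩
  · obtain ⟨x', h1, h2, h3, h4, h5⟩ :=
      exists_support_ssubset_of_circulation x z hx0 hz hzx hzL hzR
    obtain ⟨y, hy, hy'⟩ := ih _ (hcard x' h2 h3) x' h1 (by simpa only [h4] using hx1) A hm hA
      (by simpa only [h5] using hp) rfl
    exact ⟨y, hy.mono h2, by simpa only [h4] using hy'⟩
  · let K : Finset R := {v | v ≠ v₀ ∧ x u₀ v ≠ 0}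
    have hK : ∀ v, v ∈ K ↔ v ≠ v₀ ∧ x u₀ v ≠ 0 := by simp [K]
    have hKleaf : ∀ v ∈ K, ∀ u, x u v ≠ 0 → u = u₀ := fun v hv =>
      hleaf v ((hK v).1 hv).1 ((hK v).1 hv).2
    obtain ⟨θ, g, hgm, hg0, hgsupp, hg1, hgv₀, hgK, hgE, hres⟩ :=
      exists_serve_left_vertex x hx0 hx1 A hm hA hp u₀ v₀ K hK
    let x' : L → R → ℝ := fun u v => if u = u₀ then 0 else x u v
    let A' : R → Ω → unitInterval := fun j ω => residual v₀ K θ j fun i => A i ω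
    have hx'le : ∀ u v, x' u v ≤ x u v := fun u v => by
      simp only [x']
      split_ifs
      exacts [hx0 u v, le_rfl]
    have hx'0 : ∀ u v, 0 ≤ x' u v := fun u v => by
      simp only [x']
      split_ifs
      exacts [le_rfl, hx0 u v]
    have hx'supp : ∀ u v, x' u v ≠ 0 → x u v ≠ 0 := fun u v h => by
      simp only [x'] at h
      split_ifs at h
      exacts [absurd rfl h, h]
    have hx'K : ∀ v ∈ K, ∀ u, x' u v = 0 := fun v hv u => by
      by_contra h
      have := hKleaf v hv u (hx'supp u v h)
      exact h (by simp [x', this])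
    have hx'sum : ∀ v, ∑ u, x' u v = ∑ u, x u v - x u₀ v := fun v => by
      have : ∀ u, x' u v = x u v - if u = u₀ then x u v else 0 := fun u => by
        simp only [x']
        split_ifs <;> simp
      simp [this, Finset.sum_sub_distrib]
    have hx'1 : ∀ u, ∑ v, x' u v ≤ 1 := fun u =>
      (Finset.sum_le_sum fun v _ => hx'le u v).trans (hx1 u)
    have hp' : ∀ v, 1 - ratio * (1 - ∑ u, x' u v) ≤ ∫ ω, (A' v ω : ℝ) ∂μ := by
      intro v
      by_cases hv : v = v₀
      · subst hv
        rw [hx'sum]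
        exact hres
      · by_cases hvK : v ∈ K
        · simp only [A', residual_of_mem hv hvK, hx'K v hvK]
          have := ratio_pos
          simp [this.le]
        · simp only [A', residual_of_notMem hv hvK]
          refine le_trans ?_ (hp v)
          have h1 := Finset.sum_le_sum fun u (_ : u ∈ Finset.univ) => hx'le u v
          have h2 := mul_le_mul_of_nonneg_left h1 ratio_pos.le
          linarith
    obtain ⟨y', hy', hyE⟩ := ih _ (hcard x' hx'supp ⟨u₀, v₀, by simp [x'], h₀⟩) x' hx'0 hx'1 A'
      (fun v => (measurable_residual v₀ K θ v).comp (measurable_pi_lambda _ hm))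
      (hA.residual v₀ K θ) hp' rfl
    have hy'u₀ : ∀ v ω, y' u₀ v ω = 0 := fun v ω => hy'.support _ _ _ (by simp [x'])
    have hsumR : ∀ v ω, ∑ u, (y' u v ω + if u = u₀ then g v ω else 0) =
        ∑ u, y' u v ω + g v ω := fun v ω => by
      simp [Finset.sum_add_distrib]
    refine ⟨fun u v ω => y' u v ω + if u = u₀ then g v ω else 0,
      ⟨fun u v => (hy'.measurable u v).add ?_, fun u v ω => add_nonneg (hy'.nonneg u v ω) ?_,
        fun u v ω h => ?_, fun u ω => ?_, fun v ω => ?_⟩, fun u => ?_⟩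
    · split_ifs
      exacts [hgm v, measurable_const]
    · split_ifs
      exacts [hg0 v ω, le_rfl]
    · rw [hy'.support u v ω (not_imp_not.1 (hx'supp u v) h), zero_add]
      split_ifs with hu
      · subst hu
        refine hgsupp v ω ?_ fun hv => ((hK v).1 hv).2 h
        rintro rfl
        exact h₀ h
      · rfl
    · by_cases hu : u = u₀
      · subst hu
        simpa only [hy'u₀, zero_add, if_true] using hg1 ω
      · simpa only [hu, if_false, add_zero] using hy'.left_le_one u ω
    · rw [hsumR]
      have h1 := hy'.right_le v ω
      by_cases hv : v = v₀
      · subst hv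
        have h2 := hgv₀ ω
        simp only [A'] at h1
        linarith
      · by_cases hvK : v ∈ K
        · rw [Finset.sum_eq_zero fun u _ => hy'.support u v ω (hx'K v hvK u), zero_add]
          exact hgK v hvK ω
        · rw [hgsupp v ω hv hvK, add_zero]
          simpa only [A', residual_of_notMem hv hvK] using h1
    · by_cases hu : u = u₀
      · subst hu
        simpa only [hy'u₀, zero_add, if_true] using hgE
      · simpa only [hu, if_false, add_zero, x'] using hyE u

end Rounding

/-! ### Linear programming duality for bipartite matchings -/

section Duality

variable {L R : Type*} [Fintype L] [Fintype R]

/-- If the fractional matchings with right capacities `s` on the edges in `E` have weight at most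
`V`, then so does some fractional vertex cover. A hyperplane separates the attainable triples
(left capacities, right capacities, weight) from `(1, s, V)`; its coefficients give the cover. -/
theorem exists_cover_of_weight_le (E : Set (L × R)) (w : L → R → ℝ) (s : R → ℝ)
    (hs : ∀ v, 0 < s v) (V : ℝ) (hV : 0 ≤ V)
    (hmax : ∀ x : L → R → ℝ, (∀ u v, 0 ≤ x u v) → (∀ u v, (u, v) ∉ E → x u v = 0) →
      (∀ u, ∑ v, x u v ≤ 1) → (∀ v, ∑ u, x u v ≤ s v) → ∑ u, ∑ v, w u v * x u v ≤ V) :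
    ∃ (a : L → ℝ) (b : R → ℝ), (∀ u, 0 ≤ a u) ∧ (∀ v, 0 ≤ b v) ∧
      (∀ u v, (u, v) ∈ E → w u v ≤ a u + b v) ∧ ∑ u, a u + ∑ v, b v * s v ≤ V := by
  classical
  let X : Set (L → R → ℝ) := {x | (∀ u v, 0 ≤ x u v) ∧ ∀ u v, (u, v) ∉ E → x u v = 0}
  let O : Set ((L → ℝ) × (R → ℝ) × ℝ) := ⋃ x ∈ X,
    {p | (∀ u, ∑ v, x u v < p.1 u) ∧ (∀ v, ∑ u, x u v < p.2.1 v) ∧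
      p.2.2 < ∑ u, ∑ v, w u v * x u v}
  have hmemO : ∀ p, p ∈ O ↔ ∃ x ∈ X, (∀ u, ∑ v, x u v < p.1 u) ∧
      (∀ v, ∑ u, x u v < p.2.1 v) ∧ p.2.2 < ∑ u, ∑ v, w u v * x u v := fun p => by
    simp only [O, Set.mem_iUnion₂, Set.mem_ofPred_eq, exists_prop]
  have hOopen : IsOpen O := by
    refine isOpen_biUnion fun x _ => ?_
    simp only [Set.ofPred_and, Set.ofPred_forall]
    refine (isOpen_iInter_of_finite fun u => ?_).inter
      ((isOpen_iInter_of_finite fun v => ?_).inter ?_)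
    · exact isOpen_lt continuous_const (by fun_prop)
    · exact isOpen_lt continuous_const (by fun_prop)
    · exact isOpen_lt (by fun_prop) continuous_const
  have hOconv : Convex ℝ O := by
    rw [convex_iff_forall_pos]
    intro p hp p' hp' t t' ht ht' htt
    obtain ⟨x, hx, h1, h2, h3⟩ := (hmemO p).1 hp
    obtain ⟨x', hx', h1', h2', h3'⟩ := (hmemO p').1 hp'
    refine (hmemO _).2 ⟨fun u v => t * x u v + t' * x' u v,
      ⟨fun u v => ?_, fun u v h => ?_⟩, fun u => ?_, fun v => ?_, ?_⟩
    · have := hx.1 u v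
      have := hx'.1 u v
      positivity
    · simp only [hx.2 u v h, hx'.2 u v h, mul_zero, add_zero]
    · rw [Finset.sum_add_distrib, ← Finset.mul_sum, ← Finset.mul_sum]
      exact add_lt_add (mul_lt_mul_of_pos_left (h1 u) ht) (mul_lt_mul_of_pos_left (h1' u) ht')
    · rw [Finset.sum_add_distrib, ← Finset.mul_sum, ← Finset.mul_sum]
      exact add_lt_add (mul_lt_mul_of_pos_left (h2 v) ht) (mul_lt_mul_of_pos_left (h2' v) ht')
    · have : ∑ u, ∑ v, w u v * (t * x u v + t' * x' u v) =
          t * ∑ u, ∑ v, w u v * x u v + t' * ∑ u, ∑ v, w u v * x' u v := by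
        simp only [Finset.mul_sum, ← Finset.sum_add_distrib]
        exact Finset.sum_congr rfl fun u _ => Finset.sum_congr rfl fun v _ => by ring
      rw [this]
      exact add_lt_add (mul_lt_mul_of_pos_left h3 ht) (mul_lt_mul_of_pos_left h3' ht')
  have hnot : ((fun _ => 1, s, V) : (L → ℝ) × (R → ℝ) × ℝ) ∉ O := by
    rw [hmemO]
    rintro ⟨x, hx, h1, h2, h3⟩
    exact absurd (hmax x hx.1 hx.2 (fun u => (h1 u).le) fun v => (h2 v).le) (not_le.2 h3)
  obtain ⟨φ, hφ⟩ := geometric_hahn_banach_open_point hOconv hOopen hnot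
  -- the coefficients of the separating functional
  let α : L → ℝ := fun u => -φ (Pi.single u 1, 0, 0)
  let β : R → ℝ := fun v => -φ (0, Pi.single v 1, 0)
  let h : ℝ := φ (0, 0, 1)
  have hφeq : ∀ (p : L → ℝ) (p' : R → ℝ) (t : ℝ),
      φ (p, p', t) = t * h - ∑ u, p u * α u - ∑ v, p' v * β v := by
    intro p p' t
    have e1 : p = ∑ u, p u • Pi.single u (1 : ℝ) := by
      ext i; simp [Pi.single_apply]
    have e2 : p' = ∑ v, p' v • Pi.single v (1 : ℝ) := by
      ext i; simp [Pi.single_apply]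
    have e3 : ((p, p', t) : (L → ℝ) × (R → ℝ) × ℝ) =
        ∑ u, p u • ((Pi.single u 1, 0, 0) : (L → ℝ) × (R → ℝ) × ℝ) +
        ∑ v, p' v • ((0, Pi.single v 1, 0) : (L → ℝ) × (R → ℝ) × ℝ) +
        t • ((0, 0, 1) : (L → ℝ) × (R → ℝ) × ℝ) := by
      refine Prod.ext ?_ (Prod.ext ?_ ?_)
      · simpa [Prod.fst_sum, Prod.snd_sum] using e1
      · simpa [Prod.fst_sum, Prod.snd_sum] using e2
      · simp [Prod.snd_sum]
    rw [e3, map_add, map_add, map_sum, map_sum]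
    simp only [map_smul, smul_eq_mul, α, β, h, mul_neg, Finset.sum_neg_distrib]
    ring
  set D := V * h - ∑ u, α u - ∑ v, s v * β v with hD
  have hlt : ∀ (p : L → ℝ) (p' : R → ℝ) (t : ℝ), (p, p', t) ∈ O →
      t * h - ∑ u, p u * α u - ∑ v, p' v * β v < D := by
    intro p p' t hp
    have := hφ _ hp
    rw [hφeq, hφeq] at this
    simpa [hD] using this
  have hzero : (0 : L → R → ℝ) ∈ X := by simp [X]
  have hpos : 0 < h := by
    have := hlt (fun _ => 1) s (-1) ((hmemO _).2 ⟨0, hzero, by simp, by simpa using hs, by simp⟩)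
    rw [hD] at this
    simp only [one_mul] at this
    have h2 : 0 < (V + 1) * h := by linarith
    exact (mul_pos_iff_of_pos_left (by linarith)).1 h2
  -- the separating inequality extends to the closure of `O`
  have hle : ∀ x ∈ X, ∀ (p : L → ℝ) (p' : R → ℝ), (∀ u, ∑ v, x u v ≤ p u) →
      (∀ v, ∑ u, x u v ≤ p' v) →
      (∑ u, ∑ v, w u v * x u v) * h - ∑ u, p u * α u - ∑ v, p' v * β v ≤ D := by
    intro x hx p p' hp hp'
    have hε : ∀ ε : ℝ, 0 < ε → (∑ u, ∑ v, w u v * x u v) * h - ∑ u, p u * α u -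
        ∑ v, p' v * β v - ε * (h + ∑ u, α u + ∑ v, β v) ≤ D := by
      intro ε hε
      have := (hlt (fun u => p u + ε) (fun v => p' v + ε) (∑ u, ∑ v, w u v * x u v - ε)
        ((hmemO _).2 ⟨x, hx, fun u => by linarith [hp u], fun v => by linarith [hp' v],
          by simpa using hε⟩)).le
      simp only [add_mul, Finset.sum_add_distrib, ← Finset.mul_sum] at this
      linarith
    have hcont : Filter.Tendsto (fun ε : ℝ => (∑ u, ∑ v, w u v * x u v) * h - ∑ u, p u * α u -
        ∑ v, p' v * β v - ε * (h + ∑ u, α u + ∑ v, β v)) (nhdsWithin 0 (Set.Ioi 0))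
        (nhds ((∑ u, ∑ v, w u v * x u v) * h - ∑ u, p u * α u -
        ∑ v, p' v * β v - 0 * (h + ∑ u, α u + ∑ v, β v))) :=
      (Continuous.tendsto (by fun_prop) 0).mono_left nhdsWithin_le_nhds
    have := le_of_tendsto hcont (Filter.eventually_of_mem self_mem_nhdsWithin hε)
    simpa using this
  have hbounded : ∀ a : ℝ, (∀ N : ℝ, 0 ≤ N → N * a ≤ D) → a ≤ 0 := by
    intro a ha
    by_contra! hcon
    have h1 := ha (|D| / a + 1) (by positivity)
    have h2 : (|D| / a + 1) * a = |D| + a := by field_simp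
    have h3 := le_abs_self D
    linarith
  have hα : ∀ u, 0 ≤ α u := fun u => by
    have := hbounded (-α u) fun N hN => by
      have := hle 0 hzero (Pi.single u N) 0
        (fun u' => by
          simp only [Pi.zero_apply, Finset.sum_const_zero]
          exact (Pi.single_nonneg.2 hN : (0 : L → ℝ) ≤ Pi.single u N) u') (by simp)
      simpa [Pi.single_apply] using this
    linarith
  have hβ : ∀ v, 0 ≤ β v := fun v => by
    have := hbounded (-β v) fun N hN => by
      have := hle 0 hzero 0 (Pi.single v N) (by simp)
        (fun v' => by
          simp only [Pi.zero_apply, Finset.sum_const_zero]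
          exact (Pi.single_nonneg.2 hN : (0 : R → ℝ) ≤ Pi.single v N) v')
      simpa [Pi.single_apply] using this
    linarith
  refine ⟨fun u => α u / h, fun v => β v / h, fun u => div_nonneg (hα u) hpos.le,
    fun v => div_nonneg (hβ v) hpos.le, fun u v huv => ?_, ?_⟩
  · have := hbounded (w u v * h - α u - β v) fun N hN => by
      have := hle (fun u' v' => if u' = u ∧ v' = v then N else 0)
        ⟨fun u' v' => by dsimp only; split_ifs <;> simp [hN], fun u' v' h' => by
          refine if_neg ?_
          rintro ⟨rfl, rfl⟩
          exact h' huv⟩ (Pi.single u N) (Pi.single v N)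
        (fun u' => by
          by_cases hu : u' = u
          · subst hu; simp
          · simp [hu])
        (fun v' => by
          by_cases hv : v' = v
          · subst hv; simp
          · simp [hv])
      have h1 : ∑ u', ∑ v', w u' v' * (if u' = u ∧ v' = v then N else 0) = w u v * N := by
        rw [Finset.sum_eq_single u, Finset.sum_eq_single v] <;> simp +contextual
      rw [h1] at this
      simp only [Pi.single_apply, ite_mul, zero_mul, Finset.sum_ite_eq', Finset.mem_univ,
        if_true] at this
      linarith
    rw [← add_div, le_div_iff₀ hpos]
    linarith
  · have := hle 0 hzero 0 0 (by simp) (by simp)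
    simp only [Pi.zero_apply, mul_zero, Finset.sum_const_zero, zero_mul, sub_zero, hD] at this
    have h1 : ∑ u, α u / h + ∑ v, β v / h * s v = (∑ u, α u + ∑ v, s v * β v) / h := by
      rw [add_div, Finset.sum_div, Finset.sum_div]
      congr 1
      exact Finset.sum_congr rfl fun v _ => by ring
    rw [h1, div_le_iff₀ hpos]
    linarith

/-- A fractional matching of maximum weight exists. -/
theorem exists_isMaxOn_fractional (E : Set (L × R)) (w : L → R → ℝ) (s : R → ℝ)
    (hs : ∀ v, 0 < s v) :
    ∃ x : L → R → ℝ, ((∀ u v, 0 ≤ x u v) ∧ (∀ u v, (u, v) ∉ E → x u v = 0) ∧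
      (∀ u, ∑ v, x u v ≤ 1) ∧ ∀ v, ∑ u, x u v ≤ s v) ∧
      ∀ x' : L → R → ℝ, (∀ u v, 0 ≤ x' u v) → (∀ u v, (u, v) ∉ E → x' u v = 0) →
        (∀ u, ∑ v, x' u v ≤ 1) → (∀ v, ∑ u, x' u v ≤ s v) →
        ∑ u, ∑ v, w u v * x' u v ≤ ∑ u, ∑ v, w u v * x u v := by
  let C : Set (L → R → ℝ) := {x | (∀ u v, 0 ≤ x u v) ∧ (∀ u v, (u, v) ∉ E → x u v = 0) ∧
      (∀ u, ∑ v, x u v ≤ 1) ∧ ∀ v, ∑ u, x u v ≤ s v}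
  have hclosed : IsClosed C := by
    simp only [C, Set.ofPred_and, Set.ofPred_forall]
    refine IsClosed.inter ?_ (IsClosed.inter ?_ (IsClosed.inter ?_ ?_))
    · exact isClosed_iInter fun u => isClosed_iInter fun v =>
        isClosed_le continuous_const (by fun_prop)
    · exact isClosed_iInter fun u => isClosed_iInter fun v => isClosed_iInter fun _ =>
        isClosed_eq (by fun_prop) continuous_const
    · exact isClosed_iInter fun u => isClosed_le (by fun_prop) continuous_const
    · exact isClosed_iInter fun v => isClosed_le (by fun_prop) continuous_const
  have hcompact : IsCompact C := by
    refine (isCompact_Icc (a := (0 : L → R → ℝ)) (b := 1)).of_isClosed_subset hclosed ?_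
    rintro x ⟨h0, -, h1, -⟩
    exact ⟨h0, fun u v => (Finset.single_le_sum (f := fun v => x u v) (fun v _ => h0 u v)
      (Finset.mem_univ v)).trans (h1 u)⟩
  have hne : C.Nonempty := ⟨0, by simp, by simp, by simp, by simpa using fun v => (hs v).le⟩
  obtain ⟨x, hx, hmax⟩ := hcompact.exists_isMaxOn (f := fun x => ∑ u, ∑ v, w u v * x u v) hne
    (by fun_prop)
  exact ⟨x, hx, fun x' h1 h2 h3 h4 => hmax ⟨h1, h2, h3, h4⟩⟩

/-- Integrality of the bipartite matching polytope: no fractional matching has larger weight than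
the best matching. A fractional matching `x` is completed to a doubly stochastic matrix on `L ⊕ R`
with off-diagonal blocks `x` and `xᵀ`, to which Birkhoff's theorem applies. -/
theorem weight_le_maxWeightMatching (E : Finset (L × R)) (w : L × R → ℝ) (x : L → R → ℝ)
    (hx0 : ∀ u v, 0 ≤ x u v) (hxE : ∀ u v, (u, v) ∉ E → x u v = 0)
    (hxL : ∀ u, ∑ v, x u v ≤ 1) (hxR : ∀ v, ∑ u, x u v ≤ 1) :
    ∑ u, ∑ v, w (u, v) * x u v ≤ maxWeightMatching E w := by
  classical
  let M : Matrix (L ⊕ R) (L ⊕ R) ℝ := Matrix.fromBlocks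
    (Matrix.diagonal fun u => 1 - ∑ v, x u v) (Matrix.of x) (Matrix.of fun v u => x u v)
    (Matrix.diagonal fun v => 1 - ∑ u, x u v)
  have hM : M ∈ doublyStochastic ℝ (L ⊕ R) := by
    rw [mem_doublyStochastic_iff_sum]
    refine ⟨?_, ?_, ?_⟩
    · rintro (u | v) (u' | v')
      · simp only [M, Matrix.fromBlocks_apply₁₁, Matrix.diagonal_apply]
        split_ifs
        exacts [sub_nonneg.2 (hxL u), le_rfl]
      · exact hx0 u v'
      · exact hx0 u' v
      · simp only [M, Matrix.fromBlocks_apply₂₂, Matrix.diagonal_apply]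
        split_ifs
        exacts [sub_nonneg.2 (hxR v), le_rfl]
    · rintro (u | v) <;> simp [M, Matrix.diagonal_apply]
    · rintro (u | v) <;> simp [M, Matrix.diagonal_apply]
  -- weights off `E` are dropped, so that a permutation matrix becomes a matching of `E`
  let ψ : Matrix (L ⊕ R) (L ⊕ R) ℝ → ℝ := fun M =>
    ∑ e ∈ E, w e * M (Sum.inl e.1) (Sum.inr e.2)
  have hψ : ∑ u, ∑ v, w (u, v) * x u v = ψ M := by
    rw [← Fintype.sum_prod_type' (f := fun u v => w (u, v) * x u v)]
    refine (Finset.sum_subset (Finset.subset_univ E) fun e _ he => ?_).symm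
    exact mul_eq_zero_of_right _ (hxE e.1 e.2 he)
  rw [hψ]
  obtain ⟨t, ht0, ht1, htM⟩ := exists_eq_sum_perm_of_mem_doublyStochastic hM
  have hperm : ∀ σ : Equiv.Perm (L ⊕ R), ψ (σ.permMatrix ℝ) ≤ maxWeightMatching E w := by
    intro σ
    let N : Finset (L × R) := E.filter fun e => σ (Sum.inl e.1) = Sum.inr e.2
    have hN : N ∈ matchings E := by
      refine mem_matchings.2 ⟨Finset.filter_subset _ _, fun e he e' he' hne => ?_⟩
      have h1 := (Finset.mem_filter.1 he).2
      have h2 := (Finset.mem_filter.1 he').2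
      refine ⟨fun h => hne ?_, fun h => hne ?_⟩
      · rw [← h, h1] at h2
        exact Prod.ext h (Sum.inr_injective h2)
      · rw [← h, ← h1] at h2
        exact (Prod.ext (Sum.inl_injective (σ.injective h2)) h.symm).symm
    have : ψ (σ.permMatrix ℝ) = ∑ e ∈ N, w e := by
      simp only [ψ, N, Finset.sum_filter, Equiv.Perm.permMatrix, PEquiv.toMatrix_apply,
        Equiv.toPEquiv_apply, Option.mem_some_iff, mul_ite, mul_one, mul_zero, eq_comm]
    rw [this]
    exact Finset.le_sup' (fun M => ∑ e ∈ M, w e) hN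
  have hψM : ψ M = ∑ σ, t σ * ψ (σ.permMatrix ℝ) := by
    rw [← htM]
    simp only [ψ, Matrix.sum_apply, Matrix.smul_apply, smul_eq_mul, Finset.mul_sum]
    rw [Finset.sum_comm]
    exact Finset.sum_congr rfl fun σ _ => Finset.sum_congr rfl fun e _ => by ring
  rw [hψM]
  calc ∑ σ, t σ * ψ (σ.permMatrix ℝ) ≤ ∑ σ, t σ * maxWeightMatching E w :=
        Finset.sum_le_sum fun σ _ => mul_le_mul_of_nonneg_left (hperm σ) (ht0 σ)
    _ = maxWeightMatching E w := by rw [← Finset.sum_mul, ht1, one_mul]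

end Duality

/-! ### From vertex weights to edge weights -/

section Weights

theorem integrable_maxWeightMatching {L R Ω : Type*} [Finite R] [MeasurableSpace Ω]
    {μ : Measure Ω} [IsFiniteMeasure μ] (E : Finset (L × R))
    (w : L × R → ℝ) (A : R → Ω → unitInterval) (hm : ∀ v, Measurable (A v)) :
    Integrable (fun ω => maxWeightMatching (inducedEdges E {v | A v ω = 1}) w) μ := by
  have hS : Measurable fun ω => {v | A v ω = 1} :=
    measurable_set_iff.2 fun v => 
      measurableSet_setOfPred.1 (hm v (measurableSet_singleton 1))
  exact (Integrable.of_finite (f := fun S => maxWeightMatching (inducedEdges E S) w)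
    (μ := μ.map fun ω => {v | A v ω = 1})).comp_measurable hS

variable {L R Ω : Type*} [Fintype L] [Fintype R] [MeasurableSpace Ω]

/-- Weak duality, for the outcome `ω`. Only edges at right vertices of positive capacity have to be
covered. -/
theorem IsRandomMatching.weight_le {x : L → R → ℝ} {A : R → Ω → unitInterval}
    {y : L → R → Ω → ℝ} (h : IsRandomMatching x A y) (ω : Ω) (w : L → R → ℝ) (a : L → ℝ)
    (b : R → ℝ) (ha : ∀ u, 0 ≤ a u) (hb : ∀ v, 0 ≤ b v)
    (hab : ∀ u v, x u v ≠ 0 → A v ω ≠ 0 → w u v ≤ a u + b v) :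
    ∑ u, ∑ v, w u v * y u v ω ≤ ∑ u, a u + ∑ v, b v := by
  have h1 : ∀ u v, w u v * y u v ω ≤ a u * y u v ω + b v * y u v ω := by
    intro u v
    by_cases hx : x u v = 0
    · simp [h.support u v ω hx]
    by_cases hA : A v ω = 0
    · have h2 := h.right_le v ω
      rw [hA, Set.Icc.coe_zero] at h2
      have h3 := (Finset.single_le_sum (f := fun u => y u v ω) (fun u _ => h.nonneg u v ω)
        (Finset.mem_univ u)).trans h2
      simp [le_antisymm h3 (h.nonneg u v ω)]
    · rw [← add_mul]
      exact mul_le_mul_of_nonneg_right (hab u v hx hA) (h.nonneg u v ω)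
  calc ∑ u, ∑ v, w u v * y u v ω ≤ ∑ u, ∑ v, (a u * y u v ω + b v * y u v ω) :=
        Finset.sum_le_sum fun u _ => Finset.sum_le_sum fun v _ => h1 u v
    _ = ∑ u, a u * ∑ v, y u v ω + ∑ v, b v * ∑ u, y u v ω := by
        simp only [Finset.sum_add_distrib, Finset.mul_sum]
        congr 1
        exact Finset.sum_comm
    _ ≤ ∑ u, a u + ∑ v, b v :=
        add_le_add
          (Finset.sum_le_sum fun u _ => mul_le_of_le_one_right (ha u) (h.left_le_one u ω))
          (Finset.sum_le_sum fun v _ =>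
            mul_le_of_le_one_right (hb v) ((h.right_le v ω).trans (A v ω).2.2))

/-- For weights `β` on the right vertices, there is a random variable that is at most the value of
every fractional vertex cover of `β` in the random subgraph, and at least `c ∑ β x` in expectation.
The weights are decomposed into layers, and the layer on which `β` is at least a given threshold is
treated by rounding `x` restricted to it; every cover of `β` splits into covers of the layers. -/
theorem exists_le_cover_of_right_weights {μ : Measure Ω} [IsProbabilityMeasure μ]
    (x : L → R → ℝ) (hx0 : ∀ u v, 0 ≤ x u v) (hx1 : ∀ u, ∑ v, x u v ≤ 1)
    (A : R → Ω → unitInterval) (hm : ∀ v, Measurable (A v)) (hA : NegAssoc μ A)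
    (hp : ∀ v, 1 - ratio * (1 - ∑ u, x u v) ≤ ∫ ω, (A v ω : ℝ) ∂μ)
    (β : R → ℝ) (hβ : ∀ v, 0 ≤ β v) :
    ∃ N : Ω → ℝ, Integrable N μ ∧ ratio * ∑ u, ∑ v, β v * x u v ≤ ∫ ω, N ω ∂μ ∧
      ∀ ω (a : L → ℝ) (b : R → ℝ), (∀ u, 0 ≤ a u) → (∀ v, 0 ≤ b v) →
        (∀ u v, x u v ≠ 0 → A v ω ≠ 0 → β v ≤ a u + b v) → N ω ≤ ∑ u, a u + ∑ v, b v := by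
  classical
  induction hn : (Finset.univ.filter fun v => β v ≠ 0).card using
    Nat.strong_induction_on generalizing β with
  | _ n ih =>
  subst hn
  rcases (Finset.univ.filter fun v => β v ≠ 0).eq_empty_or_nonempty with hempty | hne
  · have h0 : ∀ v, β v = 0 := fun v => by
      simpa using Finset.filter_eq_empty_iff.1 hempty (Finset.mem_univ v)
    refine ⟨0, integrable_zero _ _ _, by simp [h0], fun ω a b ha hb _ => ?_⟩
    exact add_nonneg (Finset.sum_nonneg fun u _ => ha u) (Finset.sum_nonneg fun v _ => hb v)
  · obtain ⟨v₁, hv₁, hmin⟩ := Finset.exists_min_image _ β hne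
    have hv₁' : β v₁ ≠ 0 := by simpa using hv₁
    set t := β v₁
    have ht : 0 < t := lt_of_le_of_ne (hβ v₁) hv₁'.symm
    have htle : ∀ v, β v ≠ 0 → t ≤ β v := fun v hv => hmin v (by simpa using hv)
    let β' : R → ℝ := fun v => if β v = 0 then 0 else β v - t
    have hβ' : ∀ v, 0 ≤ β' v := fun v => by
      simp only [β']
      split_ifs with h
      exacts [le_rfl, sub_nonneg.2 (htle v h)]
    -- the lowest layer, of height `t`
    let x' : L → R → ℝ := fun u v => if β v = 0 then 0 else x u v
    have hx'le : ∀ u v, x' u v ≤ x u v := fun u v => by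
      simp only [x']
      split_ifs
      exacts [hx0 u v, le_rfl]
    obtain ⟨y, hy, hyE⟩ := exists_isRandomMatching (μ := μ) x'
      (fun u v => by
        simp only [x']
        split_ifs
        exacts [le_rfl, hx0 u v])
      (fun u => (Finset.sum_le_sum fun v _ => hx'le u v).trans (hx1 u)) A hm hA
      (fun v => le_trans (by
        have h1 := Finset.sum_le_sum fun u (_ : u ∈ Finset.univ) => hx'le u v
        have h2 := mul_le_mul_of_nonneg_left h1 ratio_pos.le
        linarith) (hp v))
    obtain ⟨N, hN, hNE, hNle⟩ := ih _ (Finset.card_lt_card (t := {v | β v ≠ 0})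
      ((Finset.ssubset_iff_of_subset fun v hv => by
          simp only [Finset.mem_filter, Finset.mem_univ, true_and, β'] at hv ⊢
          contrapose! hv
          simp [hv]).2
        ⟨v₁, hv₁, by simp [β', t]⟩)) β' hβ' rfl
    have hyint : ∀ u, Integrable (fun ω => ∑ v, y u v ω) μ := fun u =>
      integrable_finsetSum _ fun v _ => hy.integrable u v
    have hyint' : Integrable (fun ω => t * ∑ u, ∑ v, y u v ω) μ :=
      (integrable_finsetSum _ fun u _ => hyint u).const_mul t
    refine ⟨fun ω => N ω + t * ∑ u, ∑ v, y u v ω, hN.add hyint', ?_,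
      fun ω a b ha hb hab => ?_⟩
    · rw [integral_add hN hyint', integral_const_mul, integral_finsetSum _ fun u _ => hyint u]
      have h1 : ∑ u, ∑ v, β v * x u v =
          ∑ u, ∑ v, β' v * x u v + t * ∑ u, ∑ v, x' u v := by
        simp only [Finset.mul_sum, ← Finset.sum_add_distrib]
        refine Finset.sum_congr rfl fun u _ => Finset.sum_congr rfl fun v _ => ?_
        simp only [β', x']
        split_ifs with h
        · simp [h]
        · ring
      have h2 : ratio * ∑ u, ∑ v, x' u v ≤ ∑ u, ∫ ω, ∑ v, y u v ω ∂μ := by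
        rw [Finset.mul_sum]
        exact Finset.sum_le_sum fun u _ => hyE u
      have h3 := mul_le_mul_of_nonneg_left h2 ht.le
      rw [h1]
      linarith
    · have h1 := hNle ω (fun u => max (a u - t) 0) (fun v => min (b v) (β' v))
        (fun u => le_max_right _ _) (fun v => le_min (hb v) (hβ' v))
        (fun u v hx hAv => by
          have h := hab u v hx hAv
          have hau := ha u
          have hbv := hb v
          simp only [β']
          split_ifs with h0
          · exact add_nonneg (le_max_right _ _) (le_min hbv le_rfl)
          · rcases max_cases (a u - t) 0 with ⟨h2, _⟩ | ⟨h2, _⟩ <;>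
              rcases min_cases (b v) (β v - t) with ⟨h3, _⟩ | ⟨h3, _⟩ <;> linarith)
      have h2 := hy.weight_le ω (fun _ _ => t) (fun u => min (a u) t)
        (fun v => b v - min (b v) (β' v)) (fun u => le_min (ha u) ht.le)
        (fun v => sub_nonneg.2 (min_le_left _ _))
        (fun u v hx hAv => by
          have h0 : β v ≠ 0 := fun h0 => hx (by simp [x', h0])
          have h := hab u v (fun h => hx (by simp [x', h])) hAv
          have hau := ha u
          have hbv := hb v
          simp only [β', h0, if_false]
          rcases min_cases (a u) t with ⟨h2, _⟩ | ⟨h2, _⟩ <;>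
            rcases min_cases (b v) (β v - t) with ⟨h3, _⟩ | ⟨h3, _⟩ <;> linarith)
      have h3 : ∀ u, max (a u - t) 0 = a u - min (a u) t := fun u => by
        rcases le_total (a u) t with h | h
        · rw [min_eq_left h, max_eq_right (by linarith), sub_self]
        · rw [min_eq_right h, max_eq_left (by linarith)]
      simp only [← Finset.mul_sum, Finset.sum_sub_distrib, h3] at h1 h2
      linarith

/-- Complementary slackness: a fractional matching whose weight is at least the value of a
fractional vertex cover uses only edges that are covered with equality. -/
theorem weight_eq_of_cover_le (w : L → R → ℝ) (s : R → ℝ) (x : L → R → ℝ)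
    (hx0 : ∀ u v, 0 ≤ x u v) (hx1 : ∀ u, ∑ v, x u v ≤ 1) (hxs : ∀ v, ∑ u, x u v ≤ s v)
    (a : L → ℝ) (b : R → ℝ) (ha : ∀ u, 0 ≤ a u) (hb : ∀ v, 0 ≤ b v)
    (hab : ∀ u v, x u v ≠ 0 → w u v ≤ a u + b v)
    (hle : ∑ u, a u + ∑ v, b v * s v ≤ ∑ u, ∑ v, w u v * x u v) (u : L) (v : R)
    (huv : x u v ≠ 0) : w u v = a u + b v := by
  have hnn : ∀ u v, 0 ≤ (a u + b v - w u v) * x u v := fun u v => by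
    by_cases h : x u v = 0
    · simp [h]
    · exact mul_nonneg (sub_nonneg.2 (hab u v h)) (hx0 u v)
  have h1 : ∑ u, ∑ v, (a u + b v - w u v) * x u v =
      ∑ u, a u * ∑ v, x u v + ∑ v, b v * ∑ u, x u v - ∑ u, ∑ v, w u v * x u v := by
    simp only [sub_mul, add_mul, Finset.sum_sub_distrib, Finset.sum_add_distrib, Finset.mul_sum]
    congr 2
    exact Finset.sum_comm
  have h2 : ∑ u, a u * ∑ v, x u v ≤ ∑ u, a u :=
    Finset.sum_le_sum fun u _ => mul_le_of_le_one_right (ha u) (hx1 u)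
  have h3 : ∑ v, b v * ∑ u, x u v ≤ ∑ v, b v * s v :=
    Finset.sum_le_sum fun v _ => mul_le_mul_of_nonneg_left (hxs v) (hb v)
  have h4 : ∑ u, ∑ v, (a u + b v - w u v) * x u v = 0 :=
    le_antisymm (by linarith) (Finset.sum_nonneg fun u _ => Finset.sum_nonneg fun v _ => hnn u v)
  have h5 := (Finset.sum_eq_zero_iff_of_nonneg fun u _ =>
    Finset.sum_nonneg fun v _ => hnn u v).1 h4 u (Finset.mem_univ u)
  have h6 := (Finset.sum_eq_zero_iff_of_nonneg fun v _ => hnn u v).1 h5 v (Finset.mem_univ v)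
  have h7 := (mul_eq_zero.1 h6).resolve_right huv
  linarith

end Weights

end BipartiteMatching

theorem mainTheorem4 {L R : Type*} [Fintype L] [Fintype R]
    (E : Finset (L × R)) (w x : L × R → ℝ)
    (hw : ∀ e ∈ E, 0 ≤ w e)
    (hx : BipartiteMatching.IsFractionalMatching E x)
    {Ω : Type*} [MeasurableSpace Ω] (μ : Measure Ω) [IsProbabilityMeasure μ]
    (A : R → Ω → unitInterval)
    (hA_meas : ∀ v, Measurable (A v))
    (hA_binary : ∀ v ω, A v ω = 0 ∨ A v ω = 1)
    (hA_neg : BipartiteMatching.NegAssoc μ A)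
    (hA_prob : ∀ v, 1 - (2 * Real.sqrt 2 - 2) * (1 - BipartiteMatching.rightDegree E x v) ≤
      μ.real {ω | A v ω = 1}) :
    (2 * Real.sqrt 2 - 2) * ∑ e ∈ E, w e * x e ≤
      ∫ ω, BipartiteMatching.maxWeightMatching
        (BipartiteMatching.inducedEdges E {v | A v ω = 1}) w ∂μ := by
  classical
  open BipartiteMatching in
  change ratio * _ ≤ _
  -- the given fractional matching as a matrix
  let x₀ : L → R → ℝ := fun u v => if (u, v) ∈ E then x (u, v) else 0
  have hx₀ : ∀ u v, 0 ≤ x₀ u v := fun u v => by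
    simp only [x₀]
    split_ifs with h
    exacts [hx.nonneg _ h, le_rfl]
  have hleft : ∀ u, ∑ v, x₀ u v = leftDegree E x u := fun u => by
    rw [leftDegree, Finset.sum_filter, ← Finset.univ_inter E, ← Finset.sum_ite_mem,
      Fintype.sum_prod_type, Finset.sum_eq_single u] <;> simp +contextual [x₀]
  have hright : ∀ v, ∑ u, x₀ u v = rightDegree E x v := fun v => by
    rw [rightDegree, Finset.sum_filter, ← Finset.univ_inter E, ← Finset.sum_ite_mem,
      Fintype.sum_prod_type_right, Finset.sum_eq_single v] <;> simp +contextual [x₀]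
  have htotal : ∑ e ∈ E, w e * x e = ∑ u, ∑ v, w (u, v) * x₀ u v := by
    rw [← Fintype.sum_prod_type' (f := fun u v => w (u, v) * x₀ u v)]
    simp [x₀, Finset.sum_ite_mem]
  have hs0 : ∀ v, 0 ≤ rightDegree E x v := fun v => by
    rw [← hright]
    exact Finset.sum_nonneg fun u _ => hx₀ u v
  -- right vertices of fractional degree zero are isolated, so that all capacities are positive
  let s : R → ℝ := fun v => if 0 < rightDegree E x v then rightDegree E x v else 1
  have hs : ∀ v, 0 < s v := fun v => by
    simp only [s]
    split_ifs with h
    exacts [h, one_pos]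
  let E₀ : Set (L × R) := {e | e ∈ E ∧ 0 < rightDegree E x e.2}
  obtain ⟨z, ⟨hz0, hzE, hz1, hzs⟩, hzmax⟩ :=
    exists_isMaxOn_fractional E₀ (fun u v => w (u, v)) s hs
  have hx₀z : ∑ u, ∑ v, w (u, v) * x₀ u v ≤ ∑ u, ∑ v, w (u, v) * z u v := by
    refine hzmax x₀ hx₀ (fun u v h => ?_) (fun u => (hleft u).trans_le (hx.left_le_one u))
      fun v => ?_
    · by_contra h0
      refine h ⟨?_, lt_of_lt_of_le (lt_of_le_of_ne (hx₀ u v) (Ne.symm h0)) ?_⟩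
      · by_contra h1
        exact h0 (if_neg h1)
      · rw [← hright]
        exact Finset.single_le_sum (f := fun u => x₀ u v) (fun u _ => hx₀ u v)
          (Finset.mem_univ u)
    · rw [hright]
      simp only [s]
      split_ifs with h
      exacts [le_rfl, hx.right_le_one v]
  have hz_right : ∀ v, ∑ u, z u v ≤ rightDegree E x v := fun v => by
    by_cases h : 0 < rightDegree E x v
    · simpa only [s, h, if_true] using hzs v
    · rw [Finset.sum_eq_zero fun u _ => hzE u v fun h' => h h'.2]
      exact hs0 v
  -- optimal dual prices turn the weights on the support of `z` into sums of vertex weights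
  obtain ⟨α, β, hα, hβ, hαβ, hdual⟩ := exists_cover_of_weight_le E₀ (fun u v => w (u, v)) s hs
    (∑ u, ∑ v, w (u, v) * z u v)
    (by simpa using hzmax 0 (by simp) (by simp) (by simp) (by simpa using fun v => (hs v).le))
    hzmax
  have hmemE₀ : ∀ u v, z u v ≠ 0 → (u, v) ∈ E₀ := fun u v h => by
    by_contra h'
    exact h (hzE u v h')
  have htight : ∀ u v, z u v ≠ 0 → w (u, v) = α u + β v :=
    weight_eq_of_cover_le _ s z hz0 hz1 hzs α β hα hβ
      (fun u v h => hαβ u v (hmemE₀ u v h)) hdual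
  have hp : ∀ v, 1 - ratio * (1 - ∑ u, z u v) ≤ ∫ ω, (A v ω : ℝ) ∂μ := by
    intro v
    have h1 : ∫ ω, (A v ω : ℝ) ∂μ = μ.real {ω | A v ω = 1} := by
      have hset : MeasurableSet {ω | A v ω = 1} := hA_meas v (measurableSet_singleton 1)
      rw [← integral_indicator_one hset]
      refine integral_congr_ae (Filter.Eventually.of_forall fun ω => ?_)
      rcases hA_binary v ω with h | h <;> simp [Set.indicator, h]
    rw [h1]
    refine le_trans ?_ (hA_prob v)
    have := mul_le_mul_of_nonneg_left (hz_right v) ratio_pos.le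
    change _ ≤ 1 - ratio * _
    linarith
  obtain ⟨y, hy, hyE⟩ := exists_isRandomMatching (μ := μ) z hz0 hz1 A hA_meas hA_neg hp
  obtain ⟨N, hN, hNE, hNle⟩ :=
    exists_le_cover_of_right_weights (μ := μ) z hz0 hz1 A hA_meas hA_neg hp β hβ
  have hpoint : ∀ ω, ∑ u, ∑ v, α u * y u v ω + N ω ≤
      maxWeightMatching (inducedEdges E {v | A v ω = 1}) w := by
    intro ω
    set G := inducedEdges E {v | A v ω = 1}
    have hG : 0 ≤ maxWeightMatching G w := by
      have := Finset.le_sup' (fun M => ∑ e ∈ M, w e)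
        (mem_matchings.2 ⟨by simp, by simp⟩ : (∅ : Finset (L × R)) ∈ matchings G)
      rwa [Finset.sum_empty] at this
    -- a cover of the random subgraph of value `ν` splits into covers of `α` and of `β`
    obtain ⟨a, b, ha, hb, hab, hval⟩ := exists_cover_of_weight_le (G : Set (L × R))
      (fun u v => w (u, v)) (fun _ => 1) (fun _ => one_pos) (maxWeightMatching G w) hG
      (fun x h1 h2 h3 h4 => weight_le_maxWeightMatching G w x h1 (by simpa using h2) h3 h4)
    have hcover : ∀ u v, z u v ≠ 0 → A v ω ≠ 0 → α u + β v ≤ a u + b v := by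
      intro u v h1 h2
      rw [← htight u v h1]
      refine hab u v ?_
      simp only [G, inducedEdges, Finset.mem_coe, Finset.mem_filter]
      exact ⟨(hmemE₀ u v h1).1, (hA_binary v ω).resolve_left h2⟩
    have h1 := hy.weight_le ω (fun u _ => α u) (fun u => min (a u) (α u))
      (fun v => b v - min (b v) (β v)) (fun u => le_min (ha u) (hα u))
      (fun v => sub_nonneg.2 (min_le_left _ _))
      (fun u v h1 h2 => by
        have h := hcover u v h1 h2
        have hb' := hb v
        rcases min_cases (a u) (α u) with ⟨h2, _⟩ | ⟨h2, _⟩ <;>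
          rcases min_cases (b v) (β v) with ⟨h3, _⟩ | ⟨h3, _⟩ <;> linarith)
    have h2 := hNle ω (fun u => a u - min (a u) (α u)) (fun v => min (b v) (β v))
      (fun u => sub_nonneg.2 (min_le_left _ _)) (fun v => le_min (hb v) (hβ v))
      (fun u v h1 h2 => by
        have h := hcover u v h1 h2
        have ha' := ha u
        rcases min_cases (a u) (α u) with ⟨h2, _⟩ | ⟨h2, _⟩ <;>
          rcases min_cases (b v) (β v) with ⟨h3, _⟩ | ⟨h3, _⟩ <;> linarith)
    simp only [Finset.sum_sub_distrib, mul_one] at h1 h2 hval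
    linarith
  have hyint : ∀ u, Integrable (fun ω => ∑ v, α u * y u v ω) μ := fun u =>
    integrable_finsetSum _ fun v _ => (hy.integrable u v).const_mul _
  have hyint' : Integrable (fun ω => ∑ u, ∑ v, α u * y u v ω) μ :=
    integrable_finsetSum _ fun u _ => hyint u
  have hzsplit : ∑ u, ∑ v, w (u, v) * z u v =
      ∑ u, α u * ∑ v, z u v + ∑ u, ∑ v, β v * z u v := by
    simp only [Finset.mul_sum, ← Finset.sum_add_distrib]
    refine Finset.sum_congr rfl fun u _ => Finset.sum_congr rfl fun v _ => ?_
    by_cases h : z u v = 0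
    · simp [h]
    · rw [htight u v h, add_mul]
  calc ratio * ∑ e ∈ E, w e * x e ≤ ratio * ∑ u, ∑ v, w (u, v) * z u v := by
        rw [htotal]
        exact mul_le_mul_of_nonneg_left hx₀z ratio_pos.le
    _ = ∑ u, α u * (ratio * ∑ v, z u v) + ratio * ∑ u, ∑ v, β v * z u v := by
        rw [hzsplit, mul_add, Finset.mul_sum]
        congr 1
        exact Finset.sum_congr rfl fun u _ => by ring
    _ ≤ ∑ u, α u * ∫ ω, ∑ v, y u v ω ∂μ + ∫ ω, N ω ∂μ :=
        add_le_add (Finset.sum_le_sum fun u _ => mul_le_mul_of_nonneg_left (hyE u) (hα u)) hNE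
    _ = ∫ ω, (∑ u, ∑ v, α u * y u v ω + N ω) ∂μ := by
        rw [integral_add hyint' hN, integral_finsetSum _ fun u _ => hyint u]
        simp only [← Finset.mul_sum, integral_const_mul]
    _ ≤ _ := integral_mono (hyint'.add hN)
        (integrable_maxWeightMatching E w A hA_meas) hpoint
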